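/- Let $\sigma, r, A > 0$ and let $\{\varphi^t\}_{t\ge 0}$ be the dynamical system on $\mathbb{R}^3$ generated by the generalized Lorenz (Glukhovsky--Dolzhansky) system with $b=1$, $$\dot x = -\sigma x + \sigma y - A y z,\qquad \dot y = r x - y - x z,\qquad \dot z = -z + x y .$$ For $u\in\mathbb{R}^3$ let $D\varphi^t(u)$ be the fundamental matrix, with $D\varphi^0(u)=I$, of the linearization of the system along the solution $\varphi^t(u)$, and let $\sigma_1(t,u)\ge\sigma_2(t,u)\ge\sigma_3(t,u)>0$ be its singular values. For $d\in[0,3]$ put $$\omega_d(D\varphi^t(u)) = \sigma_1(t,u)\cdots\sigma_{\lfloor d\rfloor}(t,u)\,\sigma_{\lfloor d\rfloor+1}(t,u)^{d-\lfloor d\rfloor}$$ (the last factor being $1$ for integer $d$), and for a compact set $K\subset\mathbb{R}^3$ that is non-empty and invariant, i.e. $\varphi^t(K)=K$ for all $t\ge0$, define its Lyapunov dimension by $$\dim_{\rm L}(\{\varphi^t\}_{t\ge0},K) = \liminf_{t\to+\infty}\ \sup_{u\in K}\ \max\{d\in[0,3] : \omega_d(D\varphi^t(u))\ge 1\}.$$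 Assume that $\sigma\ge Ar$ and $$\frac{2(\sigma+2)}{\sigma+1+\sqrt{(\sigma-1)^2+4\sigma r}}\le 1 .$$ Then every non-empty compact invariant set $K$ of $\{\varphi^t\}_{t\ge0}$ satisfies $$\dim_{\rm L}(\{\varphi^t\}_{t\ge0},K)\ \le\ 3-\frac{2(\sigma+2)}{\sigma+1+\sqrt{(\sigma-1)^2+4\sigma r}} .$$ -/

import Mathlib

open Set Filter

noncomputable section

namespace LyapunovDimension

/-- The Euclidean phase space `ℝⁿ`. -/
abbrev Phase (n : ℕ) : Type := EuclideanSpace ℝ (Fin n)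

/-- `γ` solves `γ' = v(t, γ)`, `γ(0) = w` on `[0, ∞)` (one-sided derivative at `0`). -/
def IsForwardSolution {F : Type*} [NormedAddCommGroup F] [NormedSpace ℝ F]
    (v : ℝ → F → F) (w : F) (γ : ℝ → F) : Prop :=
  γ 0 = w ∧ IsIntegralCurveOn γ v (Ici 0)

open Classical in
/-- The solution on `[0, ∞)` of the initial value problem `γ' = v(t, γ)`, `γ(0) = w`.
It is only meaningful when a solution exists (and is unique) on `[0, ∞)`; this is the case for both
uses below, applied to the generalized Lorenz field with positive parameters. -/
def forwardSolution {F : Type*} [NormedAddCommGroup F] [NormedSpace ℝ F]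
    (v : ℝ → F → F) (w : F) : ℝ → F :=
  if h : ∃ γ : ℝ → F, IsForwardSolution v w γ then h.choose else fun _ => w

/-- The evolutionary operator `φᵗ(u)` of `u' = f(u)`, for times `t ≥ 0`. -/
def flow {n : ℕ} (f : Phase n → Phase n) (t : ℝ) (u : Phase n) : Phase n :=
  forwardSolution (fun _ => f) u t

/-- The fundamental matrix `Dφᵗ(u)`: the solution of the linearization
`X' = J(φᵗ(u)) X`, `X(0) = I`, along the trajectory of `u`, where `J = Df`. -/
def fundamentalMatrix {n : ℕ} (f : Phase n → Phase n) (t : ℝ) (u : Phase n) :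
    Phase n →L[ℝ] Phase n :=
  forwardSolution (fun s (X : Phase n →L[ℝ] Phase n) => (fderiv ℝ f (flow f s u)).comp X)
    (ContinuousLinearMap.id ℝ (Phase n)) t

/-- `K` is invariant: `φᵗ(K) = K` for all `t ≥ 0`. -/
def IsInvariantSet {n : ℕ} (f : Phase n → Phase n) (K : Set (Phase n)) : Prop :=
  ∀ t : ℝ, 0 ≤ t → flow f t '' K = K

/-- The singular value function `ω_d(L) = σ₁ ⋯ σ_⌊d⌋ · σ_{⌊d⌋+1} ^ (d - ⌊d⌋)` for `d ∈ [0, n]`.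
Singular values are listed in decreasing order and indexed from `0`. For integer `d` the last
factor is `1`, so this covers `d = 0` (value `1`) and `d = n` (value `σ₁ ⋯ σₙ`). -/
def singularValueFunction {n : ℕ} (d : ℝ) (L : Phase n →L[ℝ] Phase n) : ℝ :=
  (∏ i ∈ Finset.range ⌊d⌋₊, (L : Phase n →ₗ[ℝ] Phase n).singularValues i) *
    ((L : Phase n →ₗ[ℝ] Phase n).singularValues ⌊d⌋₊) ^ (d - (⌊d⌋₊ : ℝ))

/-- The local Lyapunov dimension `dim_L(φᵗ, u)`: the largest `d ∈ [0, n]` with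
`ω_d(Dφᵗ(u)) ≥ 1`. The set contains `0` and is bounded by `n`. -/
def localLyapunovDim {n : ℕ} (f : Phase n → Phase n) (t : ℝ) (u : Phase n) : ℝ :=
  sSup {d : ℝ | 0 ≤ d ∧ d ≤ n ∧ 1 ≤ singularValueFunction d (fundamentalMatrix f t u)}

/-- The finite-time Lyapunov dimension `dim_L(φᵗ, K) = sup_{u ∈ K} dim_L(φᵗ, u)`. -/
def finiteTimeLyapunovDim {n : ℕ} (f : Phase n → Phase n) (t : ℝ) (K : Set (Phase n)) : ℝ :=
  sSup (localLyapunovDim f t '' K)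

/-- The Lyapunov dimension `dim_L({φᵗ}, K) = liminf_{t → ∞} dim_L(φᵗ, K)`. -/
def lyapunovDim {n : ℕ} (f : Phase n → Phase n) (K : Set (Phase n)) : ℝ :=
  liminf (fun t : ℝ => finiteTimeLyapunovDim f t K) atTop

/-- The right-hand side of the generalized Lorenz system
`x' = -σx + σy - Ayz`, `y' = rx - y - xz`, `z' = -bz + xy`. -/
def generalizedLorenz (σ r A b : ℝ) (u : Phase 3) : Phase 3 :=
  !₂[-σ * u 0 + σ * u 1 - A * u 1 * u 2,
     r * u 0 - u 1 - u 0 * u 2,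
     -b * u 2 + u 0 * u 1]

end LyapunovDimension

end

/-! On `ℝ³`, for `2 ≤ d ≤ 3`, `ω_d = |det| σ₃^(d-3)`, so a formula for the determinant and a lower
bound on `σ₃` suffice. The divergence is constant, hence `det Dφᵗ = exp (-(σ+2)t)`
(`det_linearized_eq`). Along trajectories in `K`, `σ₃ ≥ c exp (-μt)` with `μ = (σ+1+κ)/2`, `κ =
√((σ-1)²+4σr)` (`norm_linearized_apply_ge`). If `3 - d ≤ θ < (σ+2)/μ`, the determinant wins and `ω_d
< 1` for large `t`, uniformly on `K`; then `θ` tends to `(σ+2)/μ`.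

The bound on `σ₃` is Leonov's method. In the norm `r a² + σ(b² + c²)` the coordinate `x` drops out
of the symmetrized Jacobian. The remaining dependence on `y, z` is absorbed by the derivative of a
function bounded on `K`, leaving the rate `μ` at the origin (`symmetrizedJacobian_lower_bound`). -/

namespace LyapunovDimension

/-! ### Existence of solutions and of the fundamental matrix -/

/-- A globally Lipschitz field has, on every time interval of length `δ ≤ 1 / (2 (C + 1))`, a
solution with arbitrary initial value. -/
theorem exists_hasDerivWithinAt_Icc_of_lipschitzWith {F : Type*} [NormedAddCommGroup F]
    [NormedSpace ℝ F] [CompleteSpace F] {v : ℝ → F → F} {C : NNReal}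
    (hv : ∀ t, LipschitzWith C (v t)) (hc : ∀ x, Continuous fun t => v t x)
    {δ : ℝ} (hδ : 0 ≤ δ) (hδC : δ * (2 * (C + 1)) ≤ 1) (t₀ : ℝ) (w : F) :
    ∃ α : ℝ → F, α t₀ = w ∧ ∀ t ∈ Icc t₀ (t₀ + δ),
      HasDerivWithinAt α (v t (α t)) (Icc t₀ (t₀ + δ)) t := by
  obtain ⟨M, hM⟩ := isCompact_Icc.exists_bound_of_continuousOn
    (s := Icc t₀ (t₀ + δ)) (hc w).continuousOn
  have hM0 : 0 ≤ M := (norm_nonneg _).trans (hM t₀ ⟨le_rfl, by linarith⟩)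
  lift M to NNReal using hM0
  lift δ to NNReal using hδ
  have hPL : IsPicardLindelof v (tmin := t₀) (tmax := t₀ + δ) ⟨t₀, le_rfl, by simp⟩ w
      (2 * M * δ) 0 (M + C * (2 * M * δ)) C :=
    { lipschitzOnWith := fun t _ => (hv t).lipschitzOnWith
      continuousOn := fun x _ => (hc x).continuousOn
      norm_le := fun t ht x hx => by
        have h1 : ‖v t x - v t w‖ ≤ C * ‖x - w‖ := by
          simpa [dist_eq_norm] using (hv t).dist_le_mul x w
        have h2 : ‖x - w‖ ≤ 2 * M * δ := by simpa [dist_eq_norm] using hx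
        have h3 : (C : ℝ) * ‖x - w‖ ≤ C * (2 * M * δ) := by gcongr
        have h4 : ‖v t x‖ ≤ ‖v t x - v t w‖ + ‖v t w‖ := by
          simpa using norm_add_le (v t x - v t w) (v t w)
        push_cast
        linarith [hM t ht]
      mul_max_le := by
        have h0 : (0 : ℝ) ≤ M * δ := by positivity
        have hmax : max (t₀ + (δ : ℝ) - t₀) (t₀ - t₀) = δ := by simp
        simp only [hmax]
        push_cast
        nlinarith [mul_nonneg h0 (sub_nonneg.2 hδC), mul_nonneg h0 δ.2] }
  exact hPL.exists_eq_forall_mem_Icc_hasDerivWithinAt₀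

/-- Global forward existence for globally Lipschitz fields. -/
theorem exists_isForwardSolution_of_lipschitzWith {F : Type*} [NormedAddCommGroup F]
    [NormedSpace ℝ F] [CompleteSpace F] {v : ℝ → F → F} {C : NNReal}
    (hv : ∀ t, LipschitzWith C (v t)) (hc : ∀ x, Continuous fun t => v t x) (w : F) :
    ∃ γ : ℝ → F, IsForwardSolution v w γ := by
  obtain ⟨δ, hδ, hδC⟩ : ∃ δ : ℝ, 0 < δ ∧ δ * (2 * (C + 1)) ≤ 1 :=
    ⟨1 / (2 * (C + 1)), by positivity, by field_simp; rfl⟩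
  choose α hα₀ hα using
    exists_hasDerivWithinAt_Icc_of_lipschitzWith hv hc hδ.le hδC
  let p : ℕ → F := fun n => Nat.rec w (fun k q => α (k * δ) q (k * δ + δ)) n
  have hp : ∀ n : ℕ, p (n + 1) = α (n * δ) (p n) (n * δ + δ) := fun n => rfl
  -- The step `δ` does not depend on the initial value, so local solutions can be glued on the grid
  -- `δℕ`; each piece starts where the previous one ends.
  let γ : ℝ → F := fun t => α (⌊t / δ⌋₊ * δ) (p ⌊t / δ⌋₊) t
  have hγ : ∀ n : ℕ, EqOn γ (α (n * δ) (p n)) (Icc (n * δ) (n * δ + δ)) := by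
    intro n t ht
    have ht0 : 0 ≤ t := le_trans (by positivity) ht.1
    rcases ht.2.lt_or_eq with h | h
    · have : ⌊t / δ⌋₊ = n := by
        rw [Nat.floor_eq_iff (by positivity), le_div_iff₀ hδ, div_lt_iff₀ hδ]
        exact ⟨ht.1, by linarith⟩
      simp only [γ, this]
    · have : ⌊t / δ⌋₊ = n + 1 := by
        rw [h, Nat.floor_eq_iff (by positivity), le_div_iff₀ hδ, div_lt_iff₀ hδ]
        push_cast
        constructor <;> linarith
      have e : (((n + 1 : ℕ) : ℝ)) * δ = t := by rw [h]; push_cast; ring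
      simp only [γ, this]
      rw [e, hα₀, hp, h]
  have hd : ∀ n : ℕ, ∀ t ∈ Icc (n * δ) (n * δ + δ),
      HasDerivWithinAt γ (v t (γ t)) (Icc (n * δ) (n * δ + δ)) t := by
    intro n t ht
    rw [hγ n ht]
    exact (hα (n * δ) (p n) t ht).congr (fun s hs => hγ n hs) (hγ n ht)
  refine ⟨γ, by simp [γ, hα₀, p], fun t ht => ?_⟩
  have ht : 0 ≤ t := ht
  have hr : HasDerivWithinAt γ (v t (γ t)) (Ici t) t := by
    have h1 : (⌊t / δ⌋₊ : ℝ) * δ ≤ t := by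
      rw [← le_div_iff₀ hδ]; exact Nat.floor_le (by positivity)
    have h2 : t < (⌊t / δ⌋₊ : ℝ) * δ + δ := by
      have := Nat.lt_floor_add_one (t / δ)
      rw [div_lt_iff₀ hδ] at this
      linarith
    exact (hd _ t ⟨h1, h2.le⟩).mono_of_mem_nhdsWithin
      (mem_of_superset (Icc_mem_nhdsGE h2) (Icc_subset_Icc_left h1))
  rcases ht.eq_or_lt with rfl | hpos
  · exact hr
  have hl : HasDerivWithinAt γ (v t (γ t)) (Iic t) t := by
    obtain ⟨m, hm⟩ : ∃ m : ℕ, ⌈t / δ⌉₊ = m + 1 :=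
      Nat.exists_eq_add_one.2 (Nat.ceil_pos.2 (by positivity))
    have h1 : (m : ℝ) * δ < t := by
      rw [← lt_div_iff₀ hδ]
      exact Nat.lt_ceil.1 (by omega)
    have h2 : t ≤ (m : ℝ) * δ + δ := by
      have := Nat.le_ceil (t / δ)
      rw [hm, div_le_iff₀ hδ] at this
      push_cast at this
      linarith
    exact (hd _ t ⟨h1.le, h2⟩).mono_of_mem_nhdsWithin
      (mem_of_superset (Icc_mem_nhdsLE h1) (Icc_subset_Icc_right h2))
  exact (hl.union hr).mono (by simp)

/-- `forwardSolution` is a forward solution as soon as there is one. -/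
theorem isForwardSolution_forwardSolution {F : Type*} [NormedAddCommGroup F] [NormedSpace ℝ F]
    {v : ℝ → F → F} {w : F} (h : ∃ γ, IsForwardSolution v w γ) :
    IsForwardSolution v w (forwardSolution v w) := by
  rw [forwardSolution, dif_pos h]
  exact h.choose_spec

/-- If the trajectory of `u` stays in a compact set, the fundamental matrix along it solves the
linearized equation. -/
theorem isForwardSolution_fundamentalMatrix {n : ℕ} {f : Phase n → Phase n} (hf : ContDiff ℝ 1 f)
    {K : Set (Phase n)} (hK : IsCompact K) {u : Phase n}
    (hu : IsForwardSolution (fun _ => f) u fun t => flow f t u)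
    (huK : ∀ t, 0 ≤ t → flow f t u ∈ K) :
    IsForwardSolution
      (fun s (X : Phase n →L[ℝ] Phase n) => (fderiv ℝ f (flow f s u)).comp X)
      (ContinuousLinearMap.id ℝ (Phase n)) fun t => fundamentalMatrix f t u := by
  apply isForwardSolution_forwardSolution
  have hf' : Continuous (fderiv ℝ f) := hf.continuous_fderiv one_ne_zero
  obtain ⟨M, hM⟩ := hK.exists_bound_of_continuousOn hf'.continuousOn
  have hM0 : 0 ≤ M := (norm_nonneg _).trans (hM _ (huK 0 le_rfl))
  lift M to NNReal using hM0
  -- `flow` is unspecified at negative times; freezing it there makes the coefficient continuous and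
  -- bounded on all of `ℝ`.
  let J : ℝ → Phase n →L[ℝ] Phase n := fun s => fderiv ℝ f (flow f (max s 0) u)
  have hJc : Continuous J := hf'.comp
    (hu.2.continuousOn.comp_continuous (by fun_prop) fun s => le_max_right s 0)
  obtain ⟨X, hX0, hX⟩ := exists_isForwardSolution_of_lipschitzWith (C := M)
    (v := fun s (X : Phase n →L[ℝ] Phase n) => (J s).comp X)
    (fun s => LipschitzWith.of_dist_le_mul fun X Y => by
      rw [dist_eq_norm, dist_eq_norm, ← ContinuousLinearMap.comp_sub]
      exact (ContinuousLinearMap.opNorm_comp_le _ _).trans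
        (by gcongr; exact hM _ (huK _ (le_max_right s 0))))
    (fun X => hJc.clm_comp continuous_const) (ContinuousLinearMap.id ℝ (Phase n))
  refine ⟨X, hX0, fun t ht => ?_⟩
  have := hX t ht
  simpa only [J, max_eq_left (show (0 : ℝ) ≤ t from ht)] using this

/-! ### Singular values and the Lyapunov dimension -/

/-- A lower bound for the expansion of a linear map bounds its singular values from below. -/
theorem le_singularValues_of_le_norm {E : Type*} [NormedAddCommGroup E] [InnerProductSpace ℝ E]
    [FiniteDimensional ℝ E] (T : E →ₗ[ℝ] E) {c : ℝ}
    (h : ∀ v, c * ‖v‖ ≤ ‖T v‖) {i : ℕ} (hi : i < Module.finrank ℝ E) :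
    c ≤ T.singularValues i := by
  obtain ⟨v, hv⟩ := (T.hasEigenvalue_adjoint_comp_self_sq_singularValues hi).exists_hasEigenvector
  have hv0 : 0 < ‖v‖ := norm_pos_iff.2 hv.2
  have h1 : ‖T v‖ ^ 2 = T.singularValues i ^ 2 * ‖v‖ ^ 2 := by
    have := hv.apply_eq_smul
    rw [← real_inner_self_eq_norm_sq, ← LinearMap.adjoint_inner_left]
    rw [LinearMap.comp_apply] at this
    rw [this, ← real_inner_self_eq_norm_sq v]
    simp [inner_smul_left]
  have h2 : ‖T v‖ = T.singularValues i * ‖v‖ := by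
    rw [← mul_pow] at h1
    exact (sq_eq_sq₀ (norm_nonneg _) (mul_nonneg (T.singularValues_nonneg i) hv0.le)).1 h1
  exact le_of_mul_le_mul_right (h2 ▸ h v) hv0

/-- For `2 ≤ d ≤ 3` one has `ω_d(L) = |det L| σ₃ ^ (d - 3)` for invertible `L` on `ℝ³`. -/
theorem singularValueFunction_eq_abs_det_mul (L : Phase 3 →L[ℝ] Phase 3)
    (hL : 0 < (L : Phase 3 →ₗ[ℝ] Phase 3).singularValues 2) {d : ℝ} (h2 : 2 ≤ d) (h3 : d ≤ 3) :
    singularValueFunction d L = |LinearMap.det (L : Phase 3 →ₗ[ℝ] Phase 3)| *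
      (L : Phase 3 →ₗ[ℝ] Phase 3).singularValues 2 ^ (d - 3) := by
  have hdet : |LinearMap.det (L : Phase 3 →ₗ[ℝ] Phase 3)| =
      ∏ i ∈ Finset.range 3, (L : Phase 3 →ₗ[ℝ] Phase 3).singularValues i := by
    rw [← LinearMap.normDet_eq_abs_det, LinearMap.normDet_eq_prod_singularValues]
    simp
  rw [hdet, singularValueFunction]
  rcases h3.lt_or_eq with h | rfl
  · have : ⌊d⌋₊ = 2 := by
      rw [Nat.floor_eq_iff (by linarith)]
      norm_num
      exact ⟨h2, h⟩
    rw [this, Finset.prod_range_succ _ 2, mul_assoc]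
    congr 1
    rw [show d - ((2 : ℕ) : ℝ) = 1 + (d - 3) by push_cast; ring, Real.rpow_add hL, Real.rpow_one]
  · simp

/-- A uniform bound on the singular value function near `d = 3`. -/
theorem singularValueFunction_le (L : Phase 3 →L[ℝ] Phase 3) {c D θ d : ℝ}
    (hc : 0 < c) (hc1 : c ≤ 1) (h : ∀ v, c * ‖v‖ ≤ ‖L v‖)
    (hD : |LinearMap.det (L : Phase 3 →ₗ[ℝ] Phase 3)| ≤ D)
    (hθ : θ ≤ 1) (h2 : 3 - θ ≤ d) (h3 : d ≤ 3) :
    singularValueFunction d L ≤ D * c ^ (-θ) := by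
  have hs : c ≤ (L : Phase 3 →ₗ[ℝ] Phase 3).singularValues 2 :=
    le_singularValues_of_le_norm _ h (by simp)
  rw [singularValueFunction_eq_abs_det_mul L (hc.trans_le hs) (by linarith) h3]
  have h4 : (L : Phase 3 →ₗ[ℝ] Phase 3).singularValues 2 ^ (d - 3) ≤ c ^ (-θ) :=
    (Real.rpow_le_rpow_of_nonpos hc hs (by linarith)).trans
      (Real.rpow_le_rpow_of_exponent_ge hc hc1 (by linarith))
  exact mul_le_mul hD h4 (Real.rpow_nonneg (hc.le.trans hs) _) ((abs_nonneg _).trans hD)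

/-- The Lyapunov dimension is at most `d₀` if, at arbitrarily large times, the singular value
functions of order `d ≥ d₀` are less than `1` on `K`. -/
theorem lyapunovDim_le {n : ℕ} {f : Phase n → Phase n} {K : Set (Phase n)} {d₀ : ℝ} (hd₀ : 0 ≤ d₀)
    (h : ∃ᶠ t in atTop, ∀ u ∈ K, ∀ d, d₀ ≤ d → d ≤ n →
      singularValueFunction d (fundamentalMatrix f t u) < 1) :
    lyapunovDim f K ≤ d₀ := by
  apply liminf_le_of_frequently_le
  · refine h.mono fun t ht => Real.sSup_le ?_ hd₀
    rintro _ ⟨u, hu, rfl⟩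
    refine Real.sSup_le ?_ hd₀
    rintro d ⟨_, hdn, h1⟩
    by_contra! hd
    exact absurd (ht u hu d hd.le hdn) (not_lt.2 h1)
  -- A real `liminf` is meaningful only with a lower bound, here `0`.
  · refine isBoundedUnder_of ⟨0, fun t => Real.sSup_nonneg ?_⟩
    rintro _ ⟨u, _, rfl⟩
    exact Real.sSup_nonneg fun d hd => hd.1

/-! ### Forward completeness of the Lorenz system -/

/-- Forward existence for a `C¹` field pointing inwards on the boundary of a bounded sublevel set. -/
theorem exists_isForwardSolution_of_sublevel {n : ℕ} {f : Phase n → Phase n} (hf : ContDiff ℝ 1 f)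
    {V : Phase n → ℝ} (hV : Differentiable ℝ V) {C R : ℝ} (hR : 0 < R)
    (hVR : ∀ x, V x ≤ C → ‖x‖ ≤ R) (hVf : ∀ x, V x = C → fderiv ℝ V x (f x) < 0)
    {u : Phase n} (hu : V u ≤ C) :
    ∃ γ : ℝ → Phase n, IsForwardSolution (fun _ => f) u γ := by
  -- Cutting off outside the sublevel set gives a globally Lipschitz field; its solution never
  -- leaves the set, where both fields agree.
  let χ : ContDiffBump (0 : Phase n) := ⟨R, R + 1, hR, by linarith⟩
  let g : Phase n → Phase n := fun x => χ x • f x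
  have hg : ContDiff ℝ 1 g := χ.contDiff.smul hf
  obtain ⟨M, hM⟩ := hg.lipschitzWith_of_hasCompactSupport
    (χ.hasCompactSupport.smul_right (f' := f)) one_ne_zero
  obtain ⟨γ, hγ0, hγ⟩ := exists_isForwardSolution_of_lipschitzWith (v := fun _ => g) (fun _ => hM)
    (fun _ => continuous_const) u
  have hgf : ∀ x, V x ≤ C → g x = f x := fun x hx => by
    have : χ x = 1 := χ.one_of_mem_closedBall (by simpa using hVR x hx)
    simp [g, this]
  have hVγ : ∀ t ∈ Ici (0 : ℝ),
      HasDerivWithinAt (V ∘ γ) (fderiv ℝ V (γ t) (g (γ t))) (Ici 0) t := fun t ht =>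
    (hV (γ t)).hasFDerivAt.comp_hasDerivWithinAt t (hγ t ht)
  have hle : ∀ t, 0 ≤ t → V (γ t) ≤ C := fun t ht =>
    image_le_of_deriv_right_lt_deriv_boundary' (f := V ∘ γ) (a := 0) (b := t) (B := fun _ => C)
      (B' := fun _ => 0)
      (fun s hs => ((hVγ s hs.1).continuousWithinAt).mono Icc_subset_Ici_self)
      (fun s hs => (hVγ s hs.1).mono (Ici_subset_Ici.2 hs.1)) (by simpa [hγ0] using hu)
      continuousOn_const (fun s _ => hasDerivWithinAt_const _ _ _)
      (fun s _ hs => by rw [hgf _ (le_of_eq hs)]; exact hVf _ hs) ⟨ht, le_rfl⟩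
  refine ⟨γ, hγ0, fun t ht => ?_⟩
  have : HasDerivWithinAt γ (g (γ t)) (Ici 0) t := hγ t ht
  rwa [hgf _ (hle t ht)] at this

theorem contDiff_generalizedLorenz (σ r A b : ℝ) {k : WithTop ℕ∞} :
    ContDiff ℝ k (generalizedLorenz σ r A b) := by
  rw [contDiff_euclidean]
  intro i
  fin_cases i <;> simp [generalizedLorenz] <;> fun_prop

theorem hasFDerivAt_coord {n : ℕ} (i : Fin n) (u : Phase n) :
    HasFDerivAt (fun x : Phase n => x i) (EuclideanSpace.proj i : Phase n →L[ℝ] ℝ) u :=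
  (EuclideanSpace.proj i : Phase n →L[ℝ] ℝ).hasFDerivAt

/-- The Jacobian matrix of the generalized Lorenz field. -/
theorem fderiv_generalizedLorenz_apply (σ r A b : ℝ) (u w : Phase 3) :
    fderiv ℝ (generalizedLorenz σ r A b) u w =
      !₂[-σ * w 0 + (σ - A * u 2) * w 1 - A * u 1 * w 2,
         (r - u 2) * w 0 - w 1 - u 0 * w 2,
         u 1 * w 0 + u 0 * w 1 - b * w 2] := by
  have hd : HasFDerivAt (generalizedLorenz σ r A b) (fderiv ℝ (generalizedLorenz σ r A b) u) u :=
    ((contDiff_generalizedLorenz σ r A b (k := 1)).differentiable one_ne_zero u).hasFDerivAt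
  have h0 := hasFDerivAt_coord 0 u
  have h1 := hasFDerivAt_coord 1 u
  have h2 := hasFDerivAt_coord 2 u
  have key : ∀ (i : Fin 3) (D : Phase 3 →L[ℝ] ℝ),
      HasFDerivAt (fun x => generalizedLorenz σ r A b x i) D u →
      (fderiv ℝ (generalizedLorenz σ r A b) u w) i = D w := fun i D hD =>
    DFunLike.congr_fun
      (((hasFDerivAt_coord i _).comp u hd).unique hD) w
  ext i
  fin_cases i
  · refine (key 0 _ (((h0.const_mul (-σ)).add (h1.const_mul σ)).sub
      ((h1.const_mul A).mul h2))).trans ?_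
    simp
    ring
  · refine (key 1 _ (((h0.const_mul r).sub h1).sub (h0.mul h2))).trans ?_
    simp
    ring
  · refine (key 2 _ ((h2.const_mul (-b)).add (h0.mul h1))).trans ?_
    simp
    ring

/-- The generalized Lorenz system with `b = 1` has forward solutions for all initial values. -/
theorem isForwardSolution_flow_generalizedLorenz {σ r A : ℝ} (hσ : 0 < σ) (hA : 0 < A)
    (u : Phase 3) :
    IsForwardSolution (fun _ => generalizedLorenz σ r A 1) u
      fun t => flow (generalizedLorenz σ r A 1) t u := by
  apply isForwardSolution_forwardSolution
  -- In the derivative of `V`, the weight `A + 1` cancels the `xyz` terms and `z₀` the `xy` terms.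
  obtain ⟨z₀, hz₀⟩ : ∃ z₀ : ℝ, (A + 1) * z₀ = σ + r := ⟨(σ + r) / (A + 1), by field_simp⟩
  let V : Phase 3 → ℝ := fun x => x 0 ^ 2 + x 1 ^ 2 + (A + 1) * (x 2 - z₀) ^ 2
  have hV : Differentiable ℝ V := by simp only [V]; fun_prop
  have hVd : ∀ x w : Phase 3, fderiv ℝ V x w =
      2 * x 0 * w 0 + 2 * x 1 * w 1 + (A + 1) * (2 * (x 2 - z₀) * w 2) := fun x w => by
    have h0 := hasFDerivAt_coord 0 x
    have h1 := hasFDerivAt_coord 1 x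
    have h2 := hasFDerivAt_coord 2 x
    have h : HasFDerivAt V _ x :=
      ((h0.pow 2).add (h1.pow 2)).add (((h2.sub_const z₀).pow 2).const_mul (A + 1))
    rw [h.fderiv]
    simp
  -- This `k` gives `V' ≤ 2(-k V + (A+1) z₀²)`, which is negative on `V = C` once `k C > (A+1) z₀²`.
  obtain ⟨k, hk, hkσ, hk1⟩ : ∃ k : ℝ, 0 < k ∧ k ≤ σ ∧ k ≤ 1 / 4 :=
    ⟨min σ (1 / 4), by positivity, min_le_left _ _, min_le_right _ _⟩
  have hVnn : ∀ x, 0 ≤ V x := fun x => by simp only [V]; positivity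
  obtain ⟨C, hC0, huC, hkC⟩ : ∃ C : ℝ, 0 ≤ C ∧ V u ≤ C ∧ (A + 1) * z₀ ^ 2 < k * C := by
    have h1 : 0 ≤ (A + 1) * z₀ ^ 2 / k := by positivity
    refine ⟨V u + (A + 1) * z₀ ^ 2 / k + 1, ?_, ?_, ?_⟩
    · linarith [hVnn u]
    · linarith
    · have : k * (V u + (A + 1) * z₀ ^ 2 / k + 1) = k * V u + (A + 1) * z₀ ^ 2 + k := by
        field_simp
      nlinarith [mul_nonneg hk.le (hVnn u)]
  refine exists_isForwardSolution_of_sublevel (contDiff_generalizedLorenz σ r A 1) hV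
    (C := C) (R := 4 * C + 2 * z₀ ^ 2 + 1) (by positivity) (fun x hx => ?_) (fun x hx => ?_) huC
  · have h1 : ‖x‖ ^ 2 = x 0 ^ 2 + x 1 ^ 2 + x 2 ^ 2 := by
      rw [EuclideanSpace.norm_sq_eq, Fin.sum_univ_three]; simp
    have h2 : x 0 ^ 2 + x 1 ^ 2 + (A + 1) * (x 2 - z₀) ^ 2 ≤ C := hx
    have h3 : ‖x‖ ^ 2 ≤ 4 * C + 2 * z₀ ^ 2 := by
      nlinarith [mul_nonneg hA.le (sq_nonneg (x 2 - z₀)), sq_nonneg (x 2 - 2 * z₀),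
        sq_nonneg (x 0), sq_nonneg (x 1)]
    nlinarith [sq_nonneg (‖x‖ - 1), sq_nonneg z₀]
  · have hx : x 0 ^ 2 + x 1 ^ 2 + (A + 1) * (x 2 - z₀) ^ 2 = C := hx
    rw [hVd]
    have hz : (A + 1) * z₀ * x 0 * x 1 = (σ + r) * x 0 * x 1 := by rw [hz₀]
    have e : 2 * x 0 * (generalizedLorenz σ r A 1 x) 0 + 2 * x 1 * (generalizedLorenz σ r A 1 x) 1 +
        (A + 1) * (2 * (x 2 - z₀) * (generalizedLorenz σ r A 1 x) 2) =
        2 * (-σ * x 0 ^ 2 - x 1 ^ 2 - (A + 1) * (x 2 ^ 2 - z₀ * x 2)) := by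
      simp [generalizedLorenz]
      linear_combination -2 * hz
    rw [e]
    have h1 : k * x 0 ^ 2 ≤ σ * x 0 ^ 2 := by gcongr
    have h2 : k * x 1 ^ 2 ≤ x 1 ^ 2 := by nlinarith [sq_nonneg (x 1)]
    have h3 : k * (x 2 - z₀) ^ 2 ≤ x 2 ^ 2 - z₀ * x 2 + z₀ ^ 2 := by
      nlinarith [sq_nonneg (x 2 - z₀), sq_nonneg (x 2 + z₀), sq_nonneg (x 2), sq_nonneg z₀]
    have h4 := mul_le_mul_of_nonneg_left h3 (show 0 ≤ A + 1 by linarith)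
    rw [← hx] at hkC
    nlinarith

/-! ### The quadratic form behind the bound on `σ₃` -/

/-- Nonnegativity of a quadratic form with vanishing coupling of the last two variables. -/
theorem quadraticForm_nonneg {p q P Q : ℝ} (hp : 0 ≤ p) (hq : 0 ≤ q)
    (h : P ^ 2 + Q ^ 2 ≤ 4 * p * q) (a b c : ℝ) :
    0 ≤ p * a ^ 2 + q * (b ^ 2 + c ^ 2) + a * (P * b + Q * c) := by
  have h1 : (P * b + Q * c) ^ 2 ≤ (P ^ 2 + Q ^ 2) * (b ^ 2 + c ^ 2) := by
    nlinarith [sq_nonneg (P * c - Q * b)]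
  have h2 := mul_le_mul_of_nonneg_right h (show 0 ≤ b ^ 2 + c ^ 2 by positivity)
  have h3 := mul_le_mul_of_nonneg_left (h1.trans h2) (sq_nonneg a)
  have h4 : (a * (P * b + Q * c)) ^ 2 ≤ (p * a ^ 2 + q * (b ^ 2 + c ^ 2)) ^ 2 := by
    nlinarith [sq_nonneg (p * a ^ 2 - q * (b ^ 2 + c ^ 2))]
  have h5 := abs_le_of_sq_le_sq h4 (by positivity)
  linarith [(abs_le.1 h5).1]

/-- The lower bound for the symmetrized Jacobian, corrected by the derivative
`g = r z - y² - z²` of `(y² + z²) / 2 - r z`. -/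
theorem symmetrizedJacobian_lower_bound {σ r A κ : ℝ} (hσ : 0 < σ) (hr : 0 < r) (hA : 0 < A)
    (hAr : A * r ≤ σ) (hκ : 0 < κ) (hκ2 : κ ^ 2 = (σ - 1) ^ 2 + 4 * σ * r)
    (y z a b c : ℝ) :
    0 ≤ -(σ * r * a ^ 2) - σ * b ^ 2 - σ * c ^ 2 + a * b * (2 * σ * r - z * (A * r + σ)) +
      a * c * (y * (σ - A * r)) +
      ((σ + 1 + κ) / 2 - (σ / r + A) / κ * (r * z - y ^ 2 - z ^ 2)) *
        (r * a ^ 2 + σ * b ^ 2 + σ * c ^ 2) := by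
  set g := r * z - y ^ 2 - z ^ 2 with hg
  set P := 2 * σ * r - z * (A * r + σ) with hP
  set Q := y * (σ - A * r) with hQ
  set E := κ - 2 * ((σ / r + A) / κ) * g with hE
  -- This is where `A r ≤ σ` enters: it makes both coefficients of the difference nonnegative.
  have hD : P ^ 2 + Q ^ 2 ≤ σ * r * (4 * σ * r - 4 * (σ / r + A) * g) := by
    have e : σ * r * (4 * σ * r - 4 * (σ / r + A) * g) - (P ^ 2 + Q ^ 2) =
        (σ + A * r) * (3 * σ - A * r) * z ^ 2 +
          (4 * σ * (σ + A * r) - (σ - A * r) ^ 2) * y ^ 2 := by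
      rw [hg, hP, hQ]; field_simp; ring
    have h1 : 0 ≤ A * r := by positivity
    have h2 : 0 ≤ (σ + A * r) * (3 * σ - A * r) := mul_nonneg (by linarith) (by linarith)
    have h3 : 0 ≤ 4 * σ * (σ + A * r) - (σ - A * r) ^ 2 := by nlinarith
    nlinarith [mul_nonneg h2 (sq_nonneg z), mul_nonneg h3 (sq_nonneg y)]
  obtain ⟨S, hS⟩ : ∃ S, S = (P ^ 2 + Q ^ 2) / (σ * r) := ⟨_, rfl⟩
  have hSe : S * (σ * r) = P ^ 2 + Q ^ 2 := by rw [hS]; field_simp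
  have hS0 : 0 ≤ S := by rw [hS]; positivity
  have hS1 : S ≤ 4 * σ * r - 4 * (σ / r + A) * g := by
    rw [hS, div_le_iff₀ (by positivity)]; linarith
  have hκE : κ * E = κ ^ 2 - 2 * (σ / r + A) * g := by
    rw [hE]; field_simp
  -- Squaring `κE` gives `κ²(κ² - 4(σ/r+A)g)` plus a square; the factor `1/κ` in the correction is
  -- chosen for this match.
  have hE2 : S + (σ - 1) ^ 2 ≤ E ^ 2 := by
    have h1 : κ ^ 2 * (S + (σ - 1) ^ 2) ≤ κ ^ 2 * E ^ 2 := by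
      rw [← mul_pow, hκE]
      nlinarith [sq_nonneg ((σ / r + A) * g), sq_nonneg κ]
    exact le_of_mul_le_mul_left h1 (by positivity)
  have hE0 : 0 ≤ E := by
    have : 0 ≤ κ * E := by rw [hκE]; nlinarith [sq_nonneg (σ - 1)]
    exact nonneg_of_mul_nonneg_right this hκ
  have hab : |σ - 1| ≤ E := abs_le_of_sq_le_sq (by linarith) hE0
  obtain ⟨hE1, hE3⟩ := abs_le.1 hab
  have key := quadraticForm_nonneg (p := r * (E - (σ - 1)) / 2) (q := σ * (E + (σ - 1)) / 2)
    (P := P) (Q := Q) (by apply div_nonneg (mul_nonneg hr.le (by linarith)); norm_num)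
    (by apply div_nonneg (mul_nonneg hσ.le (by linarith)); norm_num)
    (by
      have := mul_le_mul_of_nonneg_right hE2 (show 0 ≤ σ * r by positivity)
      nlinarith) a b c
  have e2 : (σ + 1 + κ) / 2 - (σ / r + A) / κ * g = (σ + 1 + E) / 2 := by rw [hE]; ring
  rw [e2]
  linarith

/-! ### Determinant and least singular value along trajectories -/

theorem hasDerivWithinAt_coord {n : ℕ} {w : ℝ → Phase n} {w' : Phase n} {s : Set ℝ} {t : ℝ}
    (h : HasDerivWithinAt w w' s t) (i : Fin n) :
    HasDerivWithinAt (fun τ => w τ i) (w' i) s t :=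
  (EuclideanSpace.proj i : Phase n →L[ℝ] ℝ).hasFDerivAt.comp_hasDerivWithinAt t h

/-- Columns of a solution of the linearized equation solve the linearized equation. -/
theorem hasDerivWithinAt_linearized_apply {σ r A b : ℝ} {γ : ℝ → Phase 3}
    {X : ℝ → Phase 3 →L[ℝ] Phase 3}
    (hX : IsForwardSolution (fun s (Y : Phase 3 →L[ℝ] Phase 3) =>
      (fderiv ℝ (generalizedLorenz σ r A b) (γ s)).comp Y) (ContinuousLinearMap.id ℝ (Phase 3)) X)
    (v : Phase 3) {t : ℝ} (ht : 0 ≤ t) :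
    HasDerivWithinAt (fun s => X s v)
      !₂[-σ * X t v 0 + (σ - A * γ t 2) * X t v 1 - A * γ t 1 * X t v 2,
         (r - γ t 2) * X t v 0 - X t v 1 - γ t 0 * X t v 2,
         γ t 1 * X t v 0 + γ t 0 * X t v 1 - b * X t v 2] (Ici 0) t := by
  have h := (hX.2 t ht).clm_apply (hasDerivWithinAt_const t (Ici 0) v)
  rw [← fderiv_generalizedLorenz_apply]
  simpa using h

/-- Liouville's formula for the generalized Lorenz system. -/
theorem det_linearized_eq {σ r A b : ℝ} {γ : ℝ → Phase 3} {X : ℝ → Phase 3 →L[ℝ] Phase 3}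
    (hX : IsForwardSolution (fun s (Y : Phase 3 →L[ℝ] Phase 3) =>
      (fderiv ℝ (generalizedLorenz σ r A b) (γ s)).comp Y) (ContinuousLinearMap.id ℝ (Phase 3)) X)
    {t : ℝ} (ht : 0 ≤ t) :
    LinearMap.det (X t : Phase 3 →ₗ[ℝ] Phase 3) = Real.exp (-(σ + 1 + b) * t) := by
  let e : Fin 3 → Phase 3 := fun j => EuclideanSpace.single j 1
  have hdet : ∀ s, LinearMap.det (X s : Phase 3 →ₗ[ℝ] Phase 3) =
      (Matrix.of fun i j => X s (e j) i).det := fun s => by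
    rw [← LinearMap.det_toMatrix (EuclideanSpace.basisFun (Fin 3) ℝ).toBasis]
    congr 1
  let D : ℝ → ℝ := fun s =>
    LinearMap.det (X s : Phase 3 →ₗ[ℝ] Phase 3) * Real.exp ((σ + 1 + b) * s)
  have hD : ∀ s ∈ Ici (0 : ℝ), HasDerivWithinAt D 0 (Ici 0) s := by
    intro s hs
    have hc := fun i j => hasDerivWithinAt_coord (hasDerivWithinAt_linearized_apply hX (e j) hs) i
    have hexp : HasDerivWithinAt (fun s => Real.exp ((σ + 1 + b) * s))
        (Real.exp ((σ + 1 + b) * s) * (σ + 1 + b)) (Ici 0) s := by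
      simpa using (((hasDerivAt_id s).const_mul (σ + 1 + b)).exp).hasDerivWithinAt
    simp only [D, hdet, Matrix.det_fin_three, Matrix.of_apply]
    refine HasDerivWithinAt.congr_deriv (((((((((hc 0 0).mul (hc 1 1)).mul (hc 2 2)).sub
      (((hc 0 0).mul (hc 1 2)).mul (hc 2 1))).sub
      (((hc 0 1).mul (hc 1 0)).mul (hc 2 2))).add
      (((hc 0 1).mul (hc 1 2)).mul (hc 2 0))).add
      (((hc 0 2).mul (hc 1 0)).mul (hc 2 1))).sub
      (((hc 0 2).mul (hc 1 1)).mul (hc 2 0))).mul hexp) ?_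
    simp
    ring
  have hconst : D t = D 0 := constant_of_has_deriv_right_zero (a := 0) (b := t)
    (fun s hs => (hD s hs.1).continuousWithinAt.mono Icc_subset_Ici_self)
    (fun s hs => (hD s hs.1).mono (Ici_subset_Ici.2 hs.1)) t ⟨ht, le_rfl⟩
  have h0 : D 0 = 1 := by simp [D, hX.1]
  rw [h0] at hconst
  rw [neg_mul, Real.exp_neg]
  exact eq_inv_of_mul_eq_one_left hconst

/-- The least singular value of the fundamental matrix along a bounded trajectory decays at most
like `exp (-μ t)`, where `-μ` is the least eigenvalue of the Jacobian at the origin. -/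
theorem norm_linearized_apply_ge {σ r A κ : ℝ} (hσ : 0 < σ) (hr : 0 < r) (hA : 0 < A)
    (hAr : A * r ≤ σ) (hκ : 0 < κ) (hκ2 : κ ^ 2 = (σ - 1) ^ 2 + 4 * σ * r)
    {K : Set (Phase 3)} (hK : IsCompact K) :
    ∃ c : ℝ, 0 < c ∧ c ≤ 1 ∧ ∀ (u : Phase 3) (γ : ℝ → Phase 3) (X : ℝ → Phase 3 →L[ℝ] Phase 3),
      IsForwardSolution (fun _ => generalizedLorenz σ r A 1) u γ → (∀ t, 0 ≤ t → γ t ∈ K) →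
      IsForwardSolution (fun s (Y : Phase 3 →L[ℝ] Phase 3) =>
        (fderiv ℝ (generalizedLorenz σ r A 1) (γ s)).comp Y)
        (ContinuousLinearMap.id ℝ (Phase 3)) X →
      ∀ t, 0 ≤ t → ∀ v, c * Real.exp (-((σ + 1 + κ) / 2) * t) * ‖v‖ ≤ ‖X t v‖ := by
  let G : Phase 3 → ℝ := fun x => (x 1 ^ 2 + x 2 ^ 2) / 2 - r * x 2
  obtain ⟨B, hB⟩ := hK.exists_bound_of_continuousOn (f := G) (by simp only [G]; fun_prop)
  set μ := (σ + 1 + κ) / 2 with hμ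
  set l := (σ / r + A) / κ with hl
  have hl0 : 0 < l := by positivity
  set m := min r σ with hm
  set M := max r σ with hM
  have hm0 : 0 < m := lt_min hr hσ
  have hmM : m ≤ M := min_le_max
  have hM0 : 0 < M := hm0.trans_le hmM
  have hsq : 0 < Real.sqrt (m / M) := Real.sqrt_pos.2 (by positivity)
  have hsq1 : Real.sqrt (m / M) ≤ 1 := Real.sqrt_le_one.2 ((div_le_one hM0).2 hmM)
  -- The root compares the weighted and Euclidean norms; the exponential accounts for the values of
  -- `G` at both ends.
  refine ⟨Real.sqrt (m / M) * Real.exp (-(2 * l * |B|)), by positivity,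
    mul_le_one₀ hsq1 (by positivity) (Real.exp_le_one_iff.2 (by
      have : 0 ≤ 2 * l * |B| := by positivity
      linarith)), ?_⟩
  intro u γ X hγ hγK hX t ht v
  let N : Phase 3 → ℝ := fun w => r * w 0 ^ 2 + σ * w 1 ^ 2 + σ * w 2 ^ 2
  have hnorm : ∀ w : Phase 3, ‖w‖ ^ 2 = w 0 ^ 2 + w 1 ^ 2 + w 2 ^ 2 := fun w => by
    rw [EuclideanSpace.norm_sq_eq, Fin.sum_univ_three]; simp
  have hNm : ∀ w, m * ‖w‖ ^ 2 ≤ N w := fun w => by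
    have h1 : m * w 0 ^ 2 ≤ r * w 0 ^ 2 := by gcongr; exact min_le_left _ _
    have h2 : m * w 1 ^ 2 ≤ σ * w 1 ^ 2 := by gcongr; exact min_le_right _ _
    have h3 : m * w 2 ^ 2 ≤ σ * w 2 ^ 2 := by gcongr; exact min_le_right _ _
    simp only [N, hnorm]; linarith
  have hNM : ∀ w, N w ≤ M * ‖w‖ ^ 2 := fun w => by
    have h1 : r * w 0 ^ 2 ≤ M * w 0 ^ 2 := by gcongr; exact le_max_left _ _
    have h2 : σ * w 1 ^ 2 ≤ M * w 1 ^ 2 := by gcongr; exact le_max_right _ _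
    have h3 : σ * w 2 ^ 2 ≤ M * w 2 ^ 2 := by gcongr; exact le_max_right _ _
    simp only [N, hnorm]; linarith
  -- `H` is nondecreasing: its derivative is twice the form of `symmetrizedJacobian_lower_bound`
  -- times the exponential.
  let H : ℝ → ℝ := fun s => N (X s v) * Real.exp (2 * μ * s - 2 * l * G (γ s))
  have hH : ∀ s ∈ Ici (0 : ℝ), ∃ H', 0 ≤ H' ∧ HasDerivWithinAt H H' (Ici 0) s := by
    intro s hs
    have hw := hasDerivWithinAt_coord (hasDerivWithinAt_linearized_apply hX v hs)
    have hg := hasDerivWithinAt_coord (hγ.2 s hs)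
    have hN := ((((hw 0).pow 2).const_mul r).add (((hw 1).pow 2).const_mul σ)).add
      (((hw 2).pow 2).const_mul σ)
    have hG := ((((hg 1).pow 2).add ((hg 2).pow 2)).div_const 2).sub ((hg 2).const_mul r)
    have hE := ((((hasDerivAt_id s).hasDerivWithinAt (s := Ici 0)).const_mul (2 * μ)).sub
      (hG.const_mul (2 * l))).exp
    refine ⟨_, ?_, hN.mul hE⟩
    have key := symmetrizedJacobian_lower_bound hσ hr hA hAr hκ hκ2 (γ s 1) (γ s 2)
      (X s v 0) (X s v 1) (X s v 2)
    rw [← hμ, ← hl] at key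
    have key2 := mul_nonneg (mul_nonneg zero_le_two key)
      (Real.exp_pos (2 * μ * s - 2 * l * G (γ s))).le
    refine key2.trans_eq ?_
    simp [generalizedLorenz, G]
    ring
  have hmono : H 0 ≤ H t := by
    choose! H' hH' hHd using hH
    have hmon : MonotoneOn H (Ici 0) := monotoneOn_of_hasDerivWithinAt_nonneg (convex_Ici 0)
      (fun s hs => (hHd s hs).continuousWithinAt)
      (fun s hs => (hHd s (interior_subset hs)).mono interior_subset)
      (fun s hs => hH' s (interior_subset hs))
    exact hmon self_mem_Ici ht ht
  have hB' : ∀ s, 0 ≤ s → |G (γ s)| ≤ |B| := fun s hs => (hB _ (hγK s hs)).trans (le_abs_self B)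
  have h0 := abs_le.1 (hB' 0 le_rfl)
  have h1 := abs_le.1 (hB' t ht)
  have hX0 : X 0 v = v := by simp [hX.1]
  have hstep : m * ‖v‖ ^ 2 * Real.exp (-(2 * l * |B|)) ≤
      M * ‖X t v‖ ^ 2 * Real.exp (2 * μ * t + 2 * l * |B|) := calc
    _ ≤ N v * Real.exp (2 * μ * 0 - 2 * l * G (γ 0)) := by
        apply mul_le_mul (hNm v) _ (Real.exp_pos _).le
          ((by positivity : 0 ≤ m * ‖v‖ ^ 2).trans (hNm v))
        exact Real.exp_le_exp.2 (by nlinarith)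
    _ = H 0 := by simp only [H, hX0]
    _ ≤ H t := hmono
    _ ≤ _ := by
        apply mul_le_mul (hNM _) _ (Real.exp_pos _).le (by positivity)
        exact Real.exp_le_exp.2 (by nlinarith)
  refine le_of_sq_le_sq ?_ (norm_nonneg _)
  have e1 : (Real.sqrt (m / M) * Real.exp (-(2 * l * |B|)) * Real.exp (-μ * t) * ‖v‖) ^ 2 =
      m * ‖v‖ ^ 2 * Real.exp (-(2 * l * |B|)) / (M * Real.exp (2 * μ * t + 2 * l * |B|)) := by
    rw [mul_pow, mul_pow, mul_pow, Real.sq_sqrt (by positivity), ← Real.exp_nat_mul,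
      ← Real.exp_nat_mul, Real.exp_add, Real.exp_neg (2 * l * |B|)]
    have e2 : Real.exp (((2 : ℕ) : ℝ) * -(2 * l * |B|)) =
        (Real.exp (2 * l * |B|))⁻¹ * (Real.exp (2 * l * |B|))⁻¹ := by
      rw [← Real.exp_neg, ← Real.exp_add]; congr 1; push_cast; ring
    have e3 : Real.exp (((2 : ℕ) : ℝ) * (-μ * t)) = (Real.exp (2 * μ * t))⁻¹ := by
      rw [← Real.exp_neg]; congr 1; push_cast; ring
    rw [e2, e3]
    field_simp
  rw [e1, div_le_iff₀ (by positivity)]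
  linarith

/-! ### Conclusion -/

/-- If `θ μ < p`, then `exp (-p t) (c exp (-μ t)) ^ (-θ)` is eventually less than `1`. -/
theorem eventually_exp_mul_rpow_lt_one {c p μ θ : ℝ} (hc : 0 < c) (h : θ * μ < p) :
    ∀ᶠ t : ℝ in atTop, Real.exp (-p * t) * (c * Real.exp (-μ * t)) ^ (-θ) < 1 := by
  have e : ∀ t : ℝ, Real.exp (-p * t) * (c * Real.exp (-μ * t)) ^ (-θ) =
      Real.exp (-θ * Real.log c - (p - θ * μ) * t) := fun t => by
    rw [Real.rpow_def_of_pos (by positivity), Real.log_mul hc.ne' (Real.exp_pos _).ne',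
      Real.log_exp, ← Real.exp_add]
    congr 1; ring
  have hp : 0 < p - θ * μ := by linarith
  filter_upwards [eventually_gt_atTop (-θ * Real.log c / (p - θ * μ))] with t ht
  rw [e, Real.exp_lt_one_iff]
  rw [div_lt_iff₀ hp] at ht
  linarith

end LyapunovDimension

open LyapunovDimension

theorem theorem4 (σ r A : ℝ) (hσ : 0 < σ) (hr : 0 < r) (hA : 0 < A) (hAr : A * r ≤ σ)
    (hcond : 2 * (σ + 2) / (σ + 1 + Real.sqrt ((σ - 1) ^ 2 + 4 * σ * r)) ≤ 1)
    (K : Set (LyapunovDimension.Phase 3)) (hKne : K.Nonempty) (hKc : IsCompact K)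
    (hKinv : LyapunovDimension.IsInvariantSet
      (LyapunovDimension.generalizedLorenz σ r A 1) K) :
    LyapunovDimension.lyapunovDim (LyapunovDimension.generalizedLorenz σ r A 1) K ≤
      3 - 2 * (σ + 2) / (σ + 1 + Real.sqrt ((σ - 1) ^ 2 + 4 * σ * r)) := by
  set κ := Real.sqrt ((σ - 1) ^ 2 + 4 * σ * r) with hκdef
  have hκ : 0 < κ := Real.sqrt_pos.2 (by positivity)
  have hκ2 : κ ^ 2 = (σ - 1) ^ 2 + 4 * σ * r := Real.sq_sqrt (by positivity)
  set θ₀ := 2 * (σ + 2) / (σ + 1 + κ) with hθ₀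
  obtain ⟨c, hc, hc1, hlow⟩ := norm_linearized_apply_ge hσ hr hA hAr hκ hκ2 hKc
  -- At `θ₀` the exponential rates balance and `c ^ (-θ)` would remain, so `θ` is taken strictly
  -- smaller. `θ₀ ≤ 1` keeps `d ≥ 2`.
  have main : ∀ θ < θ₀, lyapunovDim (generalizedLorenz σ r A 1) K ≤ 3 - θ := by
    intro θ hθ
    refine lyapunovDim_le (by linarith) (Eventually.frequently ?_)
    have hlt : θ * ((σ + 1 + κ) / 2) < σ + 1 + 1 := by
      rw [hθ₀, lt_div_iff₀ (by positivity)] at hθ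
      linarith
    filter_upwards [eventually_exp_mul_rpow_lt_one hc hlt, eventually_ge_atTop 0]
      with t htl ht u hu d hd hd3
    have hflow := isForwardSolution_flow_generalizedLorenz (r := r) hσ hA u
    have hflowK : ∀ s, 0 ≤ s → flow (generalizedLorenz σ r A 1) s u ∈ K := fun s hs =>
      hKinv s hs ▸ mem_image_of_mem _ hu
    have hX := isForwardSolution_fundamentalMatrix (contDiff_generalizedLorenz σ r A 1) hKc
      hflow hflowK
    refine lt_of_le_of_lt (singularValueFunction_le _ (by positivity) ?_
      (hlow u _ _ hflow hflowK hX t ht) ?_ (by linarith) hd (by exact_mod_cast hd3)) htl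
    · exact mul_le_one₀ hc1 (Real.exp_pos _).le (Real.exp_le_one_iff.2 (by
        have : 0 ≤ (σ + 1 + κ) / 2 * t := by positivity
        linarith))
    · rw [det_linearized_eq hX ht, abs_of_pos (Real.exp_pos _)]
  refine le_of_forall_pos_le_add fun ε hε => ?_
  linarith [main (θ₀ - ε) (by linarith)]
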